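/- Let $\mathbb T=\mathbb R/\mathbb Z$ with Lebesgue probability measure $\mu$, and for a map $\theta:\mathbb T\to\mathbb T$ and a function $f$ on $\mathbb T$ write $(T_\theta f)(x)=f(\theta x)$ and $M_n(T_\theta)f=\frac1n\sum_{k=0}^{n-1}T_\theta^kf$. There exist irrational numbers $\alpha,\beta$, for which the rotations $x\mapsto x+\alpha$ and $x\mapsto x+\beta$ of $\mathbb T$ are ergodic measure preserving transformations of $(\mathbb T,\mu)$, with induced operators $T$ and $S$ respectively, and a measurable function $f:\mathbb T\to\mathbb R$ such that for every $0<r<\frac13$ we have $\int_{\mathbb T}|f|^r\,d\mu<\infty$, $$\lim_{n\to\infty}\int_{\mathbb T}|M_n(T)f-1|^r\,d\mu=0\qquad\text{and}\qquad \lim_{n\to\infty}\int_{\mathbb T}|M_n(S)f|^r\,d\mu=0 .$$ -/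

import Mathlib

open MeasureTheory Filter Topology
open scoped ENNReal

/-- The rotation `x ↦ x + α` (mod 1) of the circle `ℝ / ℤ`. -/
def circleRotation (α : ℝ) : UnitAddCircle → UnitAddCircle :=
  fun x => x + (α : UnitAddCircle)

/-- The operator `f ↦ f ∘ θ` on real functions, induced by a transformation `θ`. -/
def koopman {X : Type*} (θ : X → X) : Module.End ℝ (X → ℝ) where
  toFun f := f ∘ θ
  map_add' _ _ := rfl
  map_smul' _ _ := rfl

/-- The averages `M_n(T) f = (1/n) ∑_{k=0}^{n-1} T^k f`. -/
noncomputable def ergodicMean {X : Type*} (T : Module.End ℝ (X → ℝ)) (n : ℕ) (f : X → ℝ) :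
    X → ℝ :=
  (n : ℝ)⁻¹ • ∑ k ∈ Finset.range n, (T ^ k) f

/-- The distance `∫ |f - g|^r dμ` of the space `L^r(μ)`, `0 < r < 1`, as an extended
nonnegative number. -/
noncomputable def lrDist {X : Type*} [MeasurableSpace X] (μ : Measure X) (r : ℝ)
    (f g : X → ℝ) : ℝ≥0∞ :=
  ∫⁻ x, ENNReal.ofReal (|f x - g x| ^ r) ∂μ

/-! For `r < 1` the constant `1` can be a sum of coboundaries `(U - U∘R_α) + (V - V∘R_β)` with `U,
V` in `L^r`; integration forbids this in `L^1`. Then `f = V - V∘R_β` is a coboundary for `β` and `1`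
plus a coboundary for `α`, and averages of coboundaries vanish in `L^r`.

To find `U, V`, take `θ ^ 3 = 2`, `α = θ`, `β = θ ^ 2`, `λ = θ - 1`, and push the density `1`
towards the origin through densities living on `[0, λ^k)` (`concentration`). Each step differs from
the next by a coboundary of `flux` for the rotation by `λ^(k+1)`. Modulo integers `λ^(k+1) = aθ +
bθ^2` with `|a|, |b| ≤ (1 + θ)^(k+1)` (`exists_coords_pow`), so it splits into coboundaries for `α`
and `β` at the price of factors `|a|, |b|`. The resulting `r`-masses are geometric with ratio `(1 +
θ) 4^r λ < 1` (`geometric_ratio_lt_one`), so the steps can be summed. -/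

/-! ### The functional `∫ |f|^r` -/

/-- The integral `∫ |f|^r dμ`. -/
noncomputable def rpowMass {X : Type*} [MeasurableSpace X] (μ : Measure X) (r : ℝ)
    (f : X → ℝ) : ℝ≥0∞ :=
  ∫⁻ x, ‖f x‖ₑ ^ r ∂μ

theorem ENNReal.tsum_rpow_le_of_le_one {r : ℝ} (hr : 0 < r) (hr1 : r ≤ 1) (a : ℕ → ℝ≥0∞) :
    (∑' k, a k) ^ r ≤ ∑' k, a k ^ r := by
  have h1 := (ENNReal.continuous_rpow_const (y := r)).continuousAt.tendsto.comp
    (ENNReal.tendsto_nat_tsum a)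
  refine le_of_tendsto' h1 fun n => ?_
  refine le_trans ?_ (ENNReal.sum_le_tsum (Finset.range n))
  exact Finset.le_sum_of_subadditive (fun t : ℝ≥0∞ => t ^ r) (ENNReal.zero_rpow_of_pos hr).le
    (fun x y => ENNReal.rpow_add_le_add_rpow x y hr.le hr1) _ _

section rpowMass

variable {X : Type*} [MeasurableSpace X] {μ : Measure X} {r : ℝ} {f g : X → ℝ}

theorem rpowMass_neg : rpowMass μ r (fun x => -f x) = rpowMass μ r f := by
  simp [rpowMass]

theorem rpowMass_congr_ae (h : f =ᵐ[μ] g) : rpowMass μ r f = rpowMass μ r g :=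
  lintegral_congr_ae (h.mono fun x hx => by simp only [hx])

theorem rpowMass_add_le (hr : 0 ≤ r) (hr1 : r ≤ 1) (hf : AEMeasurable f μ) :
    rpowMass μ r (fun x => f x + g x) ≤ rpowMass μ r f + rpowMass μ r g := by
  rw [rpowMass, rpowMass, rpowMass, ← lintegral_add_left' (hf.enorm.pow_const r)]
  refine lintegral_mono fun x => ?_
  exact (ENNReal.rpow_le_rpow (enorm_add_le _ _) hr).trans
    (ENNReal.rpow_add_le_add_rpow _ _ hr hr1)

theorem rpowMass_sub_le (hr : 0 ≤ r) (hr1 : r ≤ 1) (hf : AEMeasurable f μ) :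
    rpowMass μ r (fun x => f x - g x) ≤ rpowMass μ r f + rpowMass μ r g := by
  simpa only [sub_eq_add_neg, rpowMass_neg] using
    rpowMass_add_le (g := fun x => -g x) hr hr1 hf

theorem rpowMass_const_mul (hr : 0 ≤ r) (c : ℝ) :
    rpowMass μ r (fun x => c * f x) = ‖c‖ₑ ^ r * rpowMass μ r f := by
  simp only [rpowMass, enorm_mul, ENNReal.mul_rpow_of_nonneg _ _ hr]
  exact lintegral_const_mul' _ _ (ENNReal.rpow_ne_top_of_nonneg hr enorm_ne_top)

theorem lrDist_eq_rpowMass (hr : 0 ≤ r) :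
    lrDist μ r f g = rpowMass μ r (fun x => f x - g x) := by
  refine lintegral_congr fun x => ?_
  rw [← Real.norm_eq_abs, ← ENNReal.ofReal_rpow_of_nonneg (norm_nonneg _) hr, ofReal_norm]

/-- Subadditivity of `t ↦ t^r` lets `∑ |u k|^r` control `(∑ |u k|)^r`, replacing completeness of
`L^r`. -/
theorem ae_summable_of_tsum_rpowMass_ne_top (hr : 0 < r) (hr1 : r ≤ 1) {u : ℕ → X → ℝ}
    (hu : ∀ k, Measurable (u k)) (h : ∑' k, rpowMass μ r (u k) ≠ ∞) :
    ∀ᵐ x ∂μ, Summable fun k => u k x := by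
  unfold rpowMass at h
  rw [← lintegral_tsum fun k => ((hu k).enorm.pow_const r).aemeasurable] at h
  filter_upwards [ae_lt_top (Measurable.tsum fun k => (hu k).enorm.pow_const r) h]
    with x hx
  have h2 := (ENNReal.tsum_rpow_le_of_le_one hr hr1 fun k => ‖u k x‖ₑ).trans_lt hx
  rw [ENNReal.rpow_lt_top_iff_of_pos hr] at h2
  exact (tsum_enorm_ne_top_iff_summable_nnnorm.1 h2.ne).of_nnnorm

theorem rpowMass_tsum_le (hr : 0 < r) (hr1 : r ≤ 1) {u : ℕ → X → ℝ}
    (hu : ∀ k, Measurable (u k)) :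
    rpowMass μ r (fun x => ∑' k, u k x) ≤ ∑' k, rpowMass μ r (u k) := by
  unfold rpowMass
  rw [← lintegral_tsum fun k => ((hu k).enorm.pow_const r).aemeasurable]
  refine lintegral_mono fun x => ?_
  exact (ENNReal.rpow_le_rpow enorm_tsum_le_tsum_enorm hr.le).trans
    (ENNReal.tsum_rpow_le_of_le_one hr hr1 _)

theorem aemeasurable_tsum_of_ae_summable {u : ℕ → X → ℝ} (hu : ∀ k, Measurable (u k))
    (h : ∀ᵐ x ∂μ, Summable fun k => u k x) : AEMeasurable (fun x => ∑' k, u k x) μ := by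
  refine aemeasurable_of_tendsto_metrizable_ae atTop
    (f := fun n x => ∑ k ∈ Finset.range n, u k x)
    (fun n => (Finset.measurable_fun_sum _ fun k _ => hu k).aemeasurable) ?_
  filter_upwards [h] with x hx using hx.hasSum.tendsto_sum_nat

theorem memLp_of_rpowMass_lt_top (hr : 0 < r) (hf : AEMeasurable f μ)
    (h : rpowMass μ r f < ∞) : MemLp f (ENNReal.ofReal r) μ := by
  refine ⟨hf.aestronglyMeasurable, ?_⟩
  rw [eLpNorm_lt_top_iff_lintegral_rpow_enorm_lt_top (by simpa using hr) ENNReal.ofReal_ne_top,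
    ENNReal.toReal_ofReal hr.le]
  exact h

end rpowMass

/-! ### Rotations and coboundaries -/

theorem rpowMass_comp_add_right (r : ℝ) (f : UnitAddCircle → ℝ) (a : UnitAddCircle) :
    rpowMass volume r (fun x => f (x + a)) = rpowMass volume r f :=
  lintegral_add_right_eq_self (fun x => ‖f x‖ₑ ^ r) a

/-- Telescoping: `u` is the sum of the `n` translates `h (x + j • a)`, `j < n`, each with the same
`r`-mass. -/
theorem exists_coboundary_of_nsmul {h : UnitAddCircle → ℝ} (hh : Measurable h)
    (a : UnitAddCircle) (n : ℕ) :
    ∃ u : UnitAddCircle → ℝ, Measurable u ∧ (∀ x, h x - h (x + n • a) = u x - u (x + a)) ∧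
      ∀ r, 0 < r → r ≤ 1 → rpowMass volume r u ≤ n * rpowMass volume r h := by
  induction n with
  | zero =>
    refine ⟨fun _ => 0, measurable_const, by simp, fun r hr _ => ?_⟩
    simp [rpowMass, ENNReal.zero_rpow_of_pos hr]
  | succ n ih =>
    obtain ⟨u, hu, hcob, hmass⟩ := ih
    refine ⟨fun x => u x + h (x + n • a), by fun_prop, fun x => ?_, fun r hr hr1 => ?_⟩
    · have := hcob x
      have hadd : x + a + n • a = x + (n + 1) • a := by rw [succ_nsmul]; abel
      simp only [hadd]
      linarith
    · refine (rpowMass_add_le hr.le hr1 hu.aemeasurable).trans ?_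
      rw [rpowMass_comp_add_right]
      push_cast
      rw [add_mul, one_mul]
      gcongr
      exact hmass r hr hr1

theorem exists_coboundary_of_zsmul {h : UnitAddCircle → ℝ} (hh : Measurable h)
    (a : UnitAddCircle) (n : ℤ) :
    ∃ u : UnitAddCircle → ℝ, Measurable u ∧ (∀ x, h x - h (x + n • a) = u x - u (x + a)) ∧
      ∀ r, 0 < r → r ≤ 1 → rpowMass volume r u ≤ n.natAbs * rpowMass volume r h := by
  obtain ⟨m, rfl | rfl⟩ := n.eq_nat_or_neg
  · simpa using exists_coboundary_of_nsmul hh a m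
  · obtain ⟨u, hu, hcob, hmass⟩ :=
      exists_coboundary_of_nsmul (h := fun x => -h (x + -(m • a))) (by fun_prop) a m
    refine ⟨u, hu, fun x => ?_, fun r hr hr1 => ?_⟩
    · have := hcob x
      simp only [add_neg_cancel_right] at this
      rw [← this, neg_smul, natCast_zsmul]
      ring
    · refine (hmass r hr hr1).trans_eq ?_
      rw [rpowMass_neg, rpowMass_comp_add_right]
      simp

theorem koopman_circleRotation_pow_apply (α : ℝ) (k : ℕ) (f : UnitAddCircle → ℝ)
    (x : UnitAddCircle) :
    (koopman (circleRotation α) ^ k) f x = f (x + k • (α : UnitAddCircle)) := by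
  induction k generalizing x with
  | zero => simp
  | succ k ih =>
    rw [pow_succ', Module.End.mul_apply]
    change ((koopman (circleRotation α) ^ k) f) (x + α) = _
    rw [ih, succ_nsmul]
    congr 1
    abel

theorem ergodicMean_koopman_apply (α : ℝ) (n : ℕ) (f : UnitAddCircle → ℝ) (x : UnitAddCircle) :
    ergodicMean (koopman (circleRotation α)) n f x =
      (n : ℝ)⁻¹ * ∑ k ∈ Finset.range n, f (x + k • (α : UnitAddCircle)) := by
  simp [ergodicMean, koopman_circleRotation_pow_apply]

/-- The means of a constant plus a coboundary of an `L^r` function converge to the constant. -/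
theorem tendsto_lrDist_ergodicMean_of_coboundary {α c r : ℝ} (hr : 0 < r) (hr1 : r ≤ 1)
    {f W : UnitAddCircle → ℝ} (hW : AEMeasurable W volume) (hWr : rpowMass volume r W ≠ ∞)
    (hf : ∀ᵐ x : UnitAddCircle, f x = c + (W x - W (x + α))) :
    Tendsto (fun n : ℕ => lrDist (volume : Measure UnitAddCircle) r
      (ergodicMean (koopman (circleRotation α)) n f) (fun _ => c)) atTop (𝓝 0) := by
  have hall : ∀ᵐ x : UnitAddCircle, ∀ k : ℕ, f (x + k • (α : UnitAddCircle)) =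
      c + (W (x + k • (α : UnitAddCircle)) - W (x + (k + 1) • (α : UnitAddCircle))) := by
    refine ae_all_iff.2 fun k => ?_
    filter_upwards [(measurePreserving_add_right volume
      (k • (α : UnitAddCircle))).quasiMeasurePreserving.ae hf] with x hx
    rw [hx, succ_nsmul, add_assoc]
  have hbound : ∀ n : ℕ, 0 < n → lrDist (volume : Measure UnitAddCircle) r
      (ergodicMean (koopman (circleRotation α)) n f) (fun _ => c) ≤
      ‖(n : ℝ)⁻¹‖ₑ ^ r * (rpowMass volume r W + rpowMass volume r W) := by
    intro n hn
    rw [lrDist_eq_rpowMass hr.le]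
    -- The orbit sum telescopes, leaving two translates of `W` whose `r`-mass does not grow with
    -- `n`.
    have hae : (fun x : UnitAddCircle => ergodicMean (koopman (circleRotation α)) n f x - c)
        =ᵐ[volume] fun x => (n : ℝ)⁻¹ * (W x - W (x + n • (α : UnitAddCircle))) := by
      filter_upwards [hall] with x hx
      have hn' : (n : ℝ) ≠ 0 := by positivity
      rw [ergodicMean_koopman_apply, Finset.sum_congr rfl fun k _ => hx k,
        Finset.sum_add_distrib,
        Finset.sum_range_sub' (fun k => W (x + k • (α : UnitAddCircle)))]
      simp
      field_simp
      ring
    rw [rpowMass_congr_ae hae, rpowMass_const_mul hr.le]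
    gcongr
    refine (rpowMass_sub_le hr.le hr1 hW).trans_eq ?_
    rw [rpowMass_comp_add_right]
  have hlim : Tendsto (fun n : ℕ => ‖(n : ℝ)⁻¹‖ₑ ^ r *
      (rpowMass volume r W + rpowMass volume r W)) atTop (𝓝 0) := by
    have h1 : Tendsto (fun n : ℕ => ‖(n : ℝ)⁻¹‖ₑ ^ r) atTop (𝓝 0) := by
      have h2 : Tendsto (fun n : ℕ => ‖(n : ℝ)⁻¹‖ₑ) atTop (𝓝 0) := by
        simpa using (tendsto_inv_atTop_nhds_zero_nat (𝕜 := ℝ)).enorm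
      have := ((ENNReal.continuous_rpow_const (y := r)).tendsto 0).comp h2
      rwa [ENNReal.zero_rpow_of_pos hr] at this
    simpa using ENNReal.Tendsto.mul_const h1 (Or.inr (ENNReal.add_ne_top.2 ⟨hWr, hWr⟩))
  refine tendsto_of_tendsto_of_tendsto_of_le_of_le' tendsto_const_nhds hlim
    (Eventually.of_forall fun _ => zero_le) ?_
  filter_upwards [eventually_gt_atTop 0] with n hn using hbound n hn

theorem ergodic_circleRotation {α : ℝ} (h : Irrational α) :
    Ergodic (circleRotation α) (volume : Measure UnitAddCircle) := by
  refine AddCircle.ergodic_add_right.2 ?_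
  rw [← AddCircle.denseRange_zsmul_iff, AddCircle.denseRange_zsmul_coe_iff]
  simpa using h

/-! ### Concentrating mass on shrinking intervals -/

/-- The densities obtained from the uniform density on `[0, 1)` by moving, at step `k`, all mass of
`[0, lam ^ k)` to `[0, lam ^ (k + 1))` with translations by multiples of `lam ^ (k + 1)`. -/
noncomputable def concentration (lam : ℝ) : ℕ → ℝ → ℝ
  | 0 => (Set.Ico 0 1).indicator fun _ => 1
  | k + 1 => (Set.Ico 0 (lam ^ (k + 1))).indicator fun x =>
      ∑ j ∈ Finset.range 4, concentration lam k (x + j * lam ^ (k + 1))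

/-- The mass that is moved through each point in the `k`-th step of the concentration. -/
noncomputable def flux (lam : ℝ) (k : ℕ) : ℝ → ℝ :=
  (Set.Ici (lam ^ (k + 1))).indicator fun x =>
    ∑ j ∈ Finset.range 4, concentration lam k (x + j * lam ^ (k + 1))

section concentration

variable {lam : ℝ} {k : ℕ} {x : ℝ}

theorem concentration_eq_zero (hx : x ∉ Set.Ico 0 (lam ^ k)) : concentration lam k x = 0 := by
  cases k with
  | zero => exact Set.indicator_of_notMem (by simpa using hx) _
  | succ k => exact Set.indicator_of_notMem hx _

theorem concentration_zero (hx : x ∈ Set.Ico (0 : ℝ) 1) : concentration lam 0 x = 1 :=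
  Set.indicator_of_mem hx _

theorem measurable_concentration (lam : ℝ) (k : ℕ) : Measurable (concentration lam k) := by
  induction k with
  | zero => exact measurable_const.indicator measurableSet_Ico
  | succ k ih =>
    refine Measurable.indicator ?_ measurableSet_Ico
    fun_prop

theorem measurable_flux (lam : ℝ) (k : ℕ) : Measurable (flux lam k) := by
  refine Measurable.indicator ?_ measurableSet_Ici
  have := measurable_concentration lam k
  fun_prop

theorem abs_indicator_sum_le {φ : ℝ → ℝ} {B : ℝ} (hφ : ∀ y, |φ y| ≤ B) (s : Set ℝ) (c x : ℝ) :
    |s.indicator (fun x => ∑ j ∈ Finset.range 4, φ (x + j * c)) x| ≤ 4 * B := by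
  have hB : 0 ≤ B := (abs_nonneg _).trans (hφ 0)
  by_cases hx : x ∈ s
  · rw [Set.indicator_of_mem hx]
    refine (Finset.abs_sum_le_sum_abs _ _).trans ?_
    refine (Finset.sum_le_card_nsmul _ _ B fun j _ => hφ _).trans ?_
    simp
  · rw [Set.indicator_of_notMem hx, abs_zero]
    positivity

theorem abs_concentration_le (lam : ℝ) (k : ℕ) (x : ℝ) : |concentration lam k x| ≤ 4 ^ k := by
  induction k generalizing x with
  | zero =>
    by_cases hx : x ∈ Set.Ico (0 : ℝ) 1
    · simp [concentration_zero hx]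
    · rw [concentration_eq_zero (by simpa using hx)]; simp
  | succ k ih =>
    rw [pow_succ']
    exact abs_indicator_sum_le ih _ _ _

theorem abs_flux_le (lam : ℝ) (k : ℕ) (x : ℝ) : |flux lam k x| ≤ 4 ^ (k + 1) := by
  rw [pow_succ']
  exact abs_indicator_sum_le (abs_concentration_le lam k) _ _ _

theorem flux_of_lt (hx : x < lam ^ (k + 1)) : flux lam k x = 0 :=
  Set.indicator_of_notMem (by simpa using hx) _

theorem flux_of_le (h0 : 0 < lam) (hx : lam ^ k ≤ x) : flux lam k x = 0 := by
  refine Set.indicator_apply_eq_zero.2 fun _ => Finset.sum_eq_zero fun j _ => ?_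
  refine concentration_eq_zero fun h => ?_
  have : 0 ≤ j * lam ^ (k + 1) := by positivity
  linarith [h.2]

/-- The sum in `flux` is a tail sum along the progression of step `lam ^ (k + 1)`, so its difference
recovers one term. Four terms suffice because `lam > 1 / 4`; cutting off below `lam ^ (k + 1)`
deposits the whole sum there. -/
theorem concentration_sub_succ (h0 : 1 / 4 < lam) (h1 : lam < 1) (k : ℕ) (x : ℝ) :
    concentration lam k x - concentration lam (k + 1) x =
      flux lam k x - flux lam k (x + lam ^ (k + 1)) := by
  have hs : 0 < lam ^ (k + 1) := pow_pos (by linarith) _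
  have hL : 0 < lam ^ k := pow_pos (by linarith) _
  have hle : lam ^ (k + 1) < lam ^ k := by rw [pow_succ]; nlinarith
  have h4 : lam ^ k < 4 * lam ^ (k + 1) := by rw [pow_succ]; nlinarith
  by_cases hx0 : x < 0
  · rw [concentration_eq_zero fun h => absurd h.1 (not_le.2 hx0),
      concentration_eq_zero fun h => absurd h.1 (not_le.2 hx0),
      flux_of_lt (by linarith), flux_of_lt (by linarith)]
  push Not at hx0
  have hlast : concentration lam k (x + 4 * lam ^ (k + 1)) = 0 :=
    concentration_eq_zero fun h => by linarith [h.2]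
  have hshift : flux lam k (x + lam ^ (k + 1)) = (∑ j ∈ Finset.range 4,
      concentration lam k (x + j * lam ^ (k + 1))) - concentration lam k x := by
    rw [flux, Set.indicator_of_mem (by simpa using hx0)]
    simp only [Finset.sum_range_succ, Finset.sum_range_zero]
    norm_num
    rw [show x + lam ^ (k + 1) + lam ^ (k + 1) = x + 2 * lam ^ (k + 1) by ring,
      show x + lam ^ (k + 1) + 2 * lam ^ (k + 1) = x + 3 * lam ^ (k + 1) by ring,
      show x + lam ^ (k + 1) + 3 * lam ^ (k + 1) = x + 4 * lam ^ (k + 1) by ring, hlast]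
    ring
  rw [hshift]
  by_cases hxs : x < lam ^ (k + 1)
  · rw [flux_of_lt hxs, concentration, Set.indicator_of_mem (Set.mem_Ico.2 ⟨hx0, hxs⟩)]
    ring
  · rw [concentration_eq_zero (k := k + 1) fun h => hxs h.2, flux,
      Set.indicator_of_mem (by simpa using hxs)]
    ring

end concentration

/-! ### Transfer to the circle -/

/-- The function on the circle that is `φ` on the representatives in `[0, 1)`. -/
noncomputable def onCircle (φ : ℝ → ℝ) (x : UnitAddCircle) : ℝ :=
  φ (AddCircle.equivIco 1 0 x)

theorem equivIco_mem (x : UnitAddCircle) :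
    (AddCircle.equivIco 1 0 x : ℝ) ∈ Set.Ico (0 : ℝ) 1 := by
  simpa using (AddCircle.equivIco (1 : ℝ) 0 x).2

theorem measurable_onCircle {φ : ℝ → ℝ} (hφ : Measurable φ) : Measurable (onCircle φ) :=
  hφ.comp (measurable_subtype_coe.comp (AddCircle.measurableEquivIco 1 0).measurable)

theorem equivIco_add_coe (x : UnitAddCircle) (s : ℝ) :
    (AddCircle.equivIco 1 0 (x + (s : UnitAddCircle)) : ℝ) =
      Int.fract ((AddCircle.equivIco 1 0 x : ℝ) + s) := by
  conv_lhs => rw [← AddCircle.coe_equivIco (p := (1 : ℝ)) (a := 0) (y := x), ← AddCircle.coe_add]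
  have := AddCircle.coe_equivIco_mk_apply (1 : ℝ) ((AddCircle.equivIco 1 0 x : ℝ) + s)
  simpa using this

theorem onCircle_concentration_sub_succ {lam : ℝ} (h0 : 1 / 4 < lam) (h1 : lam < 1) (k : ℕ)
    (x : UnitAddCircle) :
    onCircle (concentration lam k) x - onCircle (concentration lam (k + 1)) x =
      onCircle (flux lam k) x - onCircle (flux lam k) (x + (lam ^ (k + 1) : ℝ)) := by
  have hs : 0 < lam ^ (k + 1) := pow_pos (by linarith) _
  have hs1 : lam ^ (k + 1) < 1 := pow_lt_one₀ (by linarith) h1 (by simp)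
  have hL : lam ^ k ≤ 1 := pow_le_one₀ (by linarith) h1.le
  have ht := equivIco_mem x
  unfold onCircle
  rw [concentration_sub_succ h0 h1, equivIco_add_coe]
  generalize (AddCircle.equivIco 1 0 x : ℝ) = t at ht ⊢
  congr 1
  by_cases hts : t + lam ^ (k + 1) < 1
  · rw [Int.fract_eq_self.2 ⟨by linarith [ht.1], hts⟩]
  · push Not at hts
    have : Int.fract (t + lam ^ (k + 1)) = t + lam ^ (k + 1) - 1 := by
      rw [Int.fract_eq_iff]
      exact ⟨by linarith, by linarith [ht.2], 1, by simp⟩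
    -- Wrapping around is harmless: the flux vanishes both past `1` and below `lam ^ (k + 1)`.
    rw [this, flux_of_le (by linarith) (hL.trans hts), flux_of_lt (by linarith [ht.2])]

theorem volume_equivIco_lt_le (L : ℝ) :
    volume {x : UnitAddCircle | (AddCircle.equivIco 1 0 x : ℝ) < L} ≤ ENNReal.ofReal L := by
  have hsub : {x : UnitAddCircle | (AddCircle.equivIco 1 0 x : ℝ) < L} ⊆
      Metric.closedBall ((L / 2 : ℝ) : UnitAddCircle) (L / 2) := by
    intro x hx
    have hx' : (AddCircle.equivIco 1 0 x : ℝ) < L := hx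
    have h0 := (equivIco_mem x).1
    rw [Metric.mem_closedBall, dist_eq_norm]
    conv_lhs => rw [← AddCircle.coe_equivIco (p := (1 : ℝ)) (a := 0) (y := x), ← AddCircle.coe_sub]
    refine (QuotientAddGroup.norm_mk_le_norm).trans ?_
    rw [Real.norm_eq_abs, abs_le]
    constructor <;> linarith
  refine (measure_mono hsub).trans ?_
  rw [AddCircle.volume_closedBall]
  exact ENNReal.ofReal_le_ofReal ((min_le_right _ _).trans (by linarith))

theorem rpowMass_onCircle_le {φ : ℝ → ℝ} {B L r : ℝ} (hr : 0 < r) (hB : ∀ t, |φ t| ≤ B)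
    (hL : ∀ t, L ≤ t → φ t = 0) :
    rpowMass volume r (onCircle φ) ≤ ENNReal.ofReal (B ^ r * L) := by
  have hB0 : 0 ≤ B := (abs_nonneg _).trans (hB 0)
  have hmeas : MeasurableSet {x : UnitAddCircle | (AddCircle.equivIco 1 0 x : ℝ) < L} :=
    measurableSet_lt
      (measurable_subtype_coe.comp (AddCircle.measurableEquivIco 1 0).measurable)
      measurable_const
  calc rpowMass volume r (onCircle φ)
      ≤ ∫⁻ x : UnitAddCircle, {x : UnitAddCircle | (AddCircle.equivIco 1 0 x : ℝ) < L}.indicator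
          (fun _ => ENNReal.ofReal (B ^ r)) x := by
        refine lintegral_mono fun x => ?_
        by_cases hx : (AddCircle.equivIco 1 0 x : ℝ) < L
        · rw [Set.indicator_of_mem
            (show x ∈ {x : UnitAddCircle | (AddCircle.equivIco 1 0 x : ℝ) < L} from hx),
            ← ENNReal.ofReal_rpow_of_nonneg hB0 hr.le, ← ofReal_norm]
          exact ENNReal.rpow_le_rpow (ENNReal.ofReal_le_ofReal (hB _)) hr.le
        · rw [Set.indicator_of_notMem
            (show x ∉ {x : UnitAddCircle | (AddCircle.equivIco 1 0 x : ℝ) < L} from hx),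
            onCircle, hL _ (not_lt.1 hx), enorm_zero,
            ENNReal.zero_rpow_of_pos hr]
    _ = ENNReal.ofReal (B ^ r) *
          volume {x : UnitAddCircle | (AddCircle.equivIco 1 0 x : ℝ) < L} :=
        lintegral_indicator_const hmeas _
    _ ≤ ENNReal.ofReal (B ^ r * L) := by
        rw [ENNReal.ofReal_mul (Real.rpow_nonneg hB0 r)]
        gcongr
        exact volume_equivIco_lt_le L

theorem rpowMass_onCircle_flux_le {lam r : ℝ} (h0 : 0 < lam) (hr : 0 < r) (k : ℕ) :
    rpowMass volume r (onCircle (flux lam k)) ≤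
      ENNReal.ofReal (((4 : ℝ) ^ (k + 1)) ^ r * lam ^ k) :=
  rpowMass_onCircle_le hr (abs_flux_le lam k) fun _ ht => flux_of_le h0 ht

/-- Away from the origin, the steps of the concentration add up to the uniform density. -/
theorem hasSum_onCircle_concentration_sub {lam : ℝ} (h0 : 0 < lam) (h1 : lam < 1)
    {x : UnitAddCircle} (hx : x ≠ 0) (hsum : Summable fun k =>
      onCircle (concentration lam k) x - onCircle (concentration lam (k + 1)) x) :
    HasSum (fun k =>
      onCircle (concentration lam k) x - onCircle (concentration lam (k + 1)) x) 1 := by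
  have hpos : 0 < (AddCircle.equivIco 1 0 x : ℝ) := by
    refine (equivIco_mem x).1.lt_of_ne fun h => hx ?_
    rw [← AddCircle.coe_equivIco (p := (1 : ℝ)) (a := 0) (y := x), ← h, AddCircle.coe_zero]
  have hlim : Tendsto (fun n => ∑ k ∈ Finset.range n,
      (onCircle (concentration lam k) x - onCircle (concentration lam (k + 1)) x))
      atTop (𝓝 1) := by
    refine tendsto_const_nhds.congr' ?_
    filter_upwards [(tendsto_pow_atTop_nhds_zero_of_lt_one h0.le h1).eventually_lt_const hpos]
      with n hn
    rw [Finset.sum_range_sub' (fun k => onCircle (concentration lam k) x), onCircle, onCircle,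
      concentration_zero (equivIco_mem x), concentration_eq_zero fun h => absurd h.2 hn.not_gt,
      sub_zero]
  exact (hsum.hasSum_iff_tendsto_nat).2 hlim

/-! ### Powers of the unit `θ - 1`, where `θ ^ 3 = 2` -/

/-- The powers of `θ - 1` have integral coordinates in the basis `1, θ, θ ^ 2`, of controlled
size. -/
theorem exists_coords_pow {θ : ℝ} (h0 : 0 < θ) (h3 : θ ^ 3 = 2) (k : ℕ) :
    ∃ c a b : ℤ, (θ - 1) ^ k = c + a * θ + b * θ ^ 2 ∧
      |(c : ℝ)| + θ * |(a : ℝ)| + θ ^ 2 * |(b : ℝ)| ≤ (1 + θ) ^ k := by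
  induction k with
  | zero => exact ⟨1, 0, 0, by simp, by simp⟩
  | succ k ih =>
    obtain ⟨c, a, b, heq, hle⟩ := ih
    -- In the weighted size, multiplication by `θ` is an isometry since `θ ^ 3 = 2`, so
    -- multiplication by `θ - 1` costs at most `1 + θ`.
    refine ⟨2 * b - c, c - a, a - b, ?_, ?_⟩
    · rw [pow_succ, heq]
      push_cast
      linear_combination (b : ℝ) * h3
    · push_cast
      have hc : |2 * (b : ℝ) - c| ≤ 2 * |(b : ℝ)| + |(c : ℝ)| := by
        simpa [abs_mul] using abs_sub (2 * (b : ℝ)) c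
      have ha := mul_le_mul_of_nonneg_left (abs_sub (c : ℝ) a) h0.le
      have hb := mul_le_mul_of_nonneg_left (abs_sub (a : ℝ) b) (sq_nonneg θ)
      calc _ ≤ (2 * |(b : ℝ)| + |(c : ℝ)|) + θ * (|(c : ℝ)| + |(a : ℝ)|) +
            θ ^ 2 * (|(a : ℝ)| + |(b : ℝ)|) := by gcongr
        _ = (|(c : ℝ)| + θ * |(a : ℝ)| + θ ^ 2 * |(b : ℝ)|) * (1 + θ) := by
            linear_combination -|(b : ℝ)| * h3
        _ ≤ (1 + θ) ^ (k + 1) := by rw [pow_succ (1 + θ)]; gcongr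

theorem exists_cube_root_two :
    ∃ θ : ℝ, θ ^ 3 = 2 ∧ 5 / 4 < θ ∧ θ < 2 ∧ Irrational θ ∧ Irrational (θ ^ 2) := by
  obtain ⟨θ, h0, h3⟩ : ∃ θ : ℝ, 0 < θ ∧ θ ^ 3 = 2 :=
    ⟨2 ^ (1 / 3 : ℝ), by positivity, by
      rw [← Real.rpow_natCast, ← Real.rpow_mul (by norm_num)]; norm_num⟩
  have hlo : 5 / 4 < θ := lt_of_pow_lt_pow_left₀ 3 h0.le (by rw [h3]; norm_num)
  have hhi : θ < 2 := lt_of_pow_lt_pow_left₀ 3 (by norm_num) (by rw [h3]; norm_num)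
  have hirr : Irrational θ := by
    refine irrational_nrt_of_notint_nrt 3 2 (by simpa using h3) ?_ (by norm_num)
    rintro ⟨m, rfl⟩
    have h1 : (1 : ℝ) < m := by linarith
    norm_cast at h1 hhi
    omega
  refine ⟨θ, h3, hlo, hhi, hirr, fun ⟨q, hq⟩ => hirr ⟨2 / q, ?_⟩⟩
  push_cast
  rw [hq, ← h3]
  field_simp

/-- At `r = 1 / 3` one has `4^r = θ^2`, and the ratio becomes `θ^4 - θ^2 = 2θ - θ^2 = 1 - (θ -
1)^2`. -/
theorem geometric_ratio_lt_one {θ r : ℝ} (h3 : θ ^ 3 = 2) (hlo : 5 / 4 < θ) (hr : r < 1 / 3) :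
    (1 + θ) * (4 ^ r * (θ - 1)) < 1 := by
  have h4 : (4 : ℝ) ^ r ≤ θ ^ 2 := by
    refine (Real.rpow_le_rpow_of_exponent_le (by norm_num) hr.le).trans_eq ?_
    rw [show (4 : ℝ) = (θ ^ 2) ^ (3 : ℝ) by
      rw [show (3 : ℝ) = (3 : ℕ) by norm_num, Real.rpow_natCast, ← pow_mul, mul_comm, pow_mul, h3]
      norm_num, ← Real.rpow_mul (by positivity)]
    norm_num
  calc (1 + θ) * (4 ^ r * (θ - 1)) ≤ (1 + θ) * (θ ^ 2 * (θ - 1)) := by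
        gcongr
        linarith
    _ = 1 - (θ - 1) ^ 2 := by linear_combination θ * h3
    _ < 1 := by nlinarith

/-- A step of the concentration is a sum of two coboundaries. -/
theorem exists_step_coboundaries {θ : ℝ} (h3 : θ ^ 3 = 2) (hlo : 5 / 4 < θ) (hhi : θ < 2)
    (k : ℕ) :
    ∃ u v : UnitAddCircle → ℝ, Measurable u ∧ Measurable v ∧
      (∀ x, onCircle (concentration (θ - 1) k) x - onCircle (concentration (θ - 1) (k + 1)) x =
        (u x - u (x + (θ : ℝ))) + (v x - v (x + (θ ^ 2 : ℝ)))) ∧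
      ∀ r, 0 < r → r < 1 / 3 →
        rpowMass volume r u ≤ ENNReal.ofReal
          ((1 + θ) * 4 ^ r * ((1 + θ) * (4 ^ r * (θ - 1))) ^ k) ∧
        rpowMass volume r v ≤ ENNReal.ofReal
          ((1 + θ) * 4 ^ r * ((1 + θ) * (4 ^ r * (θ - 1))) ^ k) := by
  obtain ⟨c, a, b, heq, hle⟩ := exists_coords_pow (by linarith) h3 (k + 1)
  have hH := measurable_onCircle (measurable_flux (θ - 1) k)
  set H := onCircle (flux (θ - 1) k)
  obtain ⟨u, hu, hucob, humass⟩ := exists_coboundary_of_zsmul hH (θ : ℝ) a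
  -- Starting from the translate of `H` by `aθ` makes the two differences telescope to the translate
  -- by `aθ + bθ^2`.
  obtain ⟨v, hv, hvcob, hvmass⟩ := exists_coboundary_of_zsmul
    (h := fun x => H (x + a • ((θ : ℝ) : UnitAddCircle))) (by fun_prop) (θ ^ 2 : ℝ) b
  have hstep : (((θ - 1) ^ (k + 1) : ℝ) : UnitAddCircle) =
      b • ((θ ^ 2 : ℝ) : UnitAddCircle) + a • ((θ : ℝ) : UnitAddCircle) := by
    have hc : ((c : ℝ) : UnitAddCircle) = 0 :=
      (AddCircle.coe_eq_zero_iff 1).2 ⟨c, by simp⟩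
    rw [heq, AddCircle.coe_add, AddCircle.coe_add, hc, zero_add, ← zsmul_eq_mul, ← zsmul_eq_mul,
      AddCircle.coe_zsmul, AddCircle.coe_zsmul, add_comm]
  have key : ∀ (n : ℤ) (r : ℝ), 0 < r → |(n : ℝ)| ≤ (1 + θ) ^ (k + 1) →
      n.natAbs * rpowMass volume r H ≤ ENNReal.ofReal
        ((1 + θ) * 4 ^ r * ((1 + θ) * (4 ^ r * (θ - 1))) ^ k) := by
    intro n r hr hn
    have hflux := rpowMass_onCircle_flux_le (lam := θ - 1) (by linarith) hr k
    have hcast : ((n.natAbs : ℕ) : ℝ≥0∞) = ENNReal.ofReal |(n : ℝ)| := by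
      rw [← Int.cast_abs, Int.abs_eq_natAbs, Int.cast_natCast, ENNReal.ofReal_natCast]
    rw [hcast]
    refine (mul_le_mul' (ENNReal.ofReal_le_ofReal hn) hflux).trans_eq ?_
    have hpow : ((4 : ℝ) ^ (k + 1)) ^ r = (4 ^ r) ^ (k + 1) := by
      rw [← Real.rpow_natCast, ← Real.rpow_mul (by norm_num), mul_comm, Real.rpow_mul (by norm_num),
        Real.rpow_natCast]
    rw [← ENNReal.ofReal_mul (by positivity), hpow, mul_pow, mul_pow]
    congr 1
    ring
  have ha : |(a : ℝ)| ≤ (1 + θ) ^ (k + 1) := by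
    nlinarith [abs_nonneg (a : ℝ), abs_nonneg (b : ℝ), abs_nonneg (c : ℝ),
      mul_nonneg (sq_nonneg θ) (abs_nonneg (b : ℝ))]
  have hb : |(b : ℝ)| ≤ (1 + θ) ^ (k + 1) := by
    have : 1 ≤ θ ^ 2 := by nlinarith
    nlinarith [abs_nonneg (b : ℝ), abs_nonneg (c : ℝ),
      mul_nonneg (show 0 ≤ θ by linarith) (abs_nonneg (a : ℝ))]
  refine ⟨u, v, hu, hv, fun x => ?_, fun r hr hr3 => ⟨?_, ?_⟩⟩
  · rw [onCircle_concentration_sub_succ (by linarith) (by linarith), ← hucob, ← hvcob, hstep,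
      ← add_assoc]
    ring
  · exact (humass r hr (by linarith)).trans (key a r hr ha)
  · refine (hvmass r hr (by linarith)).trans ?_
    rw [rpowMass_comp_add_right]
    exact key b r hr hb

theorem tsum_rpowMass_ne_top {C q r : ℝ} (hC : 0 ≤ C) (hq0 : 0 ≤ q) (hq1 : q < 1)
    {u : ℕ → UnitAddCircle → ℝ}
    (hu : ∀ k, rpowMass volume r (u k) ≤ ENNReal.ofReal (C * q ^ k)) :
    ∑' k, rpowMass volume r (u k) ≠ ∞ := by
  refine ne_top_of_le_ne_top ?_ (ENNReal.tsum_le_tsum hu)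
  rw [← ENNReal.ofReal_tsum_of_nonneg (fun k => by positivity)
    ((summable_geometric_of_lt_one hq0 hq1).mul_left C)]
  exact ENNReal.ofReal_ne_top

/-- The constant `1` is a sum of two coboundaries with transfer functions in `L^r`, `r < 1/3`. -/
theorem exists_coboundaries_add_eq_one {θ : ℝ} (h3 : θ ^ 3 = 2) (hlo : 5 / 4 < θ) (hhi : θ < 2) :
    ∃ U V : UnitAddCircle → ℝ, AEMeasurable U volume ∧ AEMeasurable V volume ∧
      (∀ r, 0 < r → r < 1 / 3 → rpowMass volume r U ≠ ∞ ∧ rpowMass volume r V ≠ ∞) ∧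
      ∀ᵐ x : UnitAddCircle,
        (U x - U (x + (θ : ℝ))) + (V x - V (x + (θ ^ 2 : ℝ))) = 1 := by
  choose u v hu hv hcob hmass using exists_step_coboundaries h3 hlo hhi
  have hq : ∀ r : ℝ, 0 ≤ (1 + θ) * (4 ^ r * (θ - 1)) := fun r =>
    mul_nonneg (by linarith) (mul_nonneg (by positivity) (by linarith))
  have hC : ∀ r : ℝ, 0 ≤ (1 + θ) * 4 ^ r := fun r => by positivity
  have hU : ∀ r, 0 < r → r < 1 / 3 → ∑' k, rpowMass volume r (u k) ≠ ∞ := fun r hr hr3 =>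
    tsum_rpowMass_ne_top (hC r) (hq r) (geometric_ratio_lt_one h3 hlo hr3)
      fun k => (hmass k r hr hr3).1
  have hV : ∀ r, 0 < r → r < 1 / 3 → ∑' k, rpowMass volume r (v k) ≠ ∞ := fun r hr hr3 =>
    tsum_rpowMass_ne_top (hC r) (hq r) (geometric_ratio_lt_one h3 hlo hr3)
      fun k => (hmass k r hr hr3).2
  -- Any single exponent below `1 / 3` gives convergence, and the sums do not depend on it.
  have hUs : ∀ᵐ x : UnitAddCircle, Summable fun k => u k x :=
    ae_summable_of_tsum_rpowMass_ne_top (r := 1 / 4) (by norm_num) (by norm_num) hu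
      (hU _ (by norm_num) (by norm_num))
  have hVs : ∀ᵐ x : UnitAddCircle, Summable fun k => v k x :=
    ae_summable_of_tsum_rpowMass_ne_top (r := 1 / 4) (by norm_num) (by norm_num) hv
      (hV _ (by norm_num) (by norm_num))
  refine ⟨fun x => ∑' k, u k x, fun x => ∑' k, v k x, aemeasurable_tsum_of_ae_summable hu hUs,
    aemeasurable_tsum_of_ae_summable hv hVs, fun r hr hr3 => ⟨?_, ?_⟩, ?_⟩
  · exact ne_top_of_le_ne_top (hU r hr hr3) (rpowMass_tsum_le hr (by linarith) hu)
  · exact ne_top_of_le_ne_top (hV r hr hr3) (rpowMass_tsum_le hr (by linarith) hv)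
  have hne : ∀ᵐ x : UnitAddCircle, x ≠ 0 := by
    refine measure_mono_null (t := Metric.closedBall (0 : UnitAddCircle) 0) ?_ ?_
    · intro x hx
      have : x = 0 := by simpa using hx
      simp [this]
    · rw [AddCircle.volume_closedBall]
      simp
  filter_upwards [hne, hUs, hVs,
    (measurePreserving_add_right volume
      ((θ : ℝ) : UnitAddCircle)).quasiMeasurePreserving.ae hUs,
    (measurePreserving_add_right volume
      ((θ ^ 2 : ℝ) : UnitAddCircle)).quasiMeasurePreserving.ae hVs]
    with x hx hux hvx hux' hvx'
  have hs := (hux.hasSum.sub hux'.hasSum).add (hvx.hasSum.sub hvx'.hasSum)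
  -- The summed coboundaries are also the telescoping series of densities, whose sum is `1` off the
  -- origin.
  simp only [← hcob] at hs
  exact hs.unique
    (hasSum_onCircle_concentration_sub (by linarith) (by linarith) hx hs.summable)

theorem proposition2p6 :
    ∃ α β : ℝ, Irrational α ∧ Irrational β ∧
      Ergodic (circleRotation α) (volume : Measure UnitAddCircle) ∧
      Ergodic (circleRotation β) (volume : Measure UnitAddCircle) ∧
      ∃ f : UnitAddCircle → ℝ, ∀ r : ℝ, 0 < r → r < 1 / 3 →
        MemLp f (ENNReal.ofReal r) (volume : Measure UnitAddCircle) ∧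
        Tendsto (fun n : ℕ => lrDist (volume : Measure UnitAddCircle) r
          (ergodicMean (koopman (circleRotation α)) n f) (fun _ => 1)) atTop (𝓝 0) ∧
        Tendsto (fun n : ℕ => lrDist (volume : Measure UnitAddCircle) r
          (ergodicMean (koopman (circleRotation β)) n f) (fun _ => 0)) atTop (𝓝 0) := by
  obtain ⟨θ, h3, hlo, hhi, hα, hβ⟩ := exists_cube_root_two
  obtain ⟨U, V, hU, hV, hmass, hone⟩ := exists_coboundaries_add_eq_one h3 hlo hhi
  refine ⟨θ, θ ^ 2, hα, hβ, ergodic_circleRotation hα, ergodic_circleRotation hβ,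
    fun x => V x - V (x + (θ ^ 2 : ℝ)), fun r hr hr3 => ⟨?_, ?_, ?_⟩⟩
  · refine memLp_of_rpowMass_lt_top hr ?_ ?_
    · exact hV.sub (hV.comp_quasiMeasurePreserving
        (measurePreserving_add_right volume _).quasiMeasurePreserving)
    · refine (rpowMass_sub_le hr.le (by linarith) hV).trans_lt ?_
      rw [rpowMass_comp_add_right]
      exact ENNReal.add_lt_top.2 ⟨(hmass r hr hr3).2.lt_top, (hmass r hr hr3).2.lt_top⟩
  · refine tendsto_lrDist_ergodicMean_of_coboundary (W := fun x => -U x) hr (by linarith)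
      hU.neg (by rw [rpowMass_neg]; exact (hmass r hr hr3).1) ?_
    filter_upwards [hone] with x hx
    linarith
  · exact tendsto_lrDist_ergodicMean_of_coboundary hr (by linarith) hV (hmass r hr hr3).2
      (Eventually.of_forall fun x => by simp)
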